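/- Let $G$ be a compact connected Lie group with identity $e$ and Borel $\sigma$-algebra. Let $N=(N(t))_{t\ge 0}$ be a Poisson process with parameter $\lambda>0$ on a probability space, let $(X_n)_{n\ge 1}$ be i.i.d. $G$-valued random variables on the same space such that the family $(X_n)_{n\ge1}$ is independent of the process $N$, put $X_0=e$, and let $$Y(t)=\prod_{n=0}^{N(t)}X_n = X_0X_1\cdots X_{N(t)},\qquad t\ge 0,$$ with products ordered from left to right, be the associated left compound Poisson process. Call a $G$-valued random variable $Z$ inverse invariant if $Z\stackrel{d}{=}Z^{-1}$, and conjugate invariant if $Z\stackrel{d}{=}kZk^{-1}$ for all $k\in G$, where $\stackrel{d}{=}$ denotes equality in distribution. Then for every $t\ge 0$: 1. If $X_1$ is inverse invariant, then so is $Y(t)$. 2. If $X_1$ is conjugate invariant, then so is $Y(t)$. -/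

import Mathlib

open MeasureTheory ProbabilityTheory
open scoped NNReal Manifold

/-- `N` is a Poisson process with rate `lam` under `P`: a counting process starting at `0` whose
increments are independent, with `N t - N s` Poisson distributed with mean `lam * (t - s)`.
The paths are almost surely nondecreasing, so for `s ≤ t` the subtraction of natural numbers is the
true one almost surely. -/
structure IsPoissonProcess {Ω : Type*} [MeasurableSpace Ω] (lam : ℝ≥0) (N : ℝ≥0 → Ω → ℕ)
    (P : Measure Ω) : Prop where
  measurable : ∀ t, Measurable (N t)
  start_zero : ∀ᵐ ω ∂P, N 0 ω = 0
  mono : ∀ᵐ ω ∂P, Monotone fun t ↦ N t ω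
  rightCont : ∀ᵐ ω ∂P, ∀ t, ContinuousWithinAt (fun s ↦ N s ω) (Set.Ici t) t
  indepIncrements : HasIndepIncrements N P
  law_increment : ∀ s t, s ≤ t →
    HasLaw (fun ω ↦ N t ω - N s ω) (poissonMeasure (lam * (t - s))) P

/-- The data of a `G`-valued compound Poisson process with parameter `lam`: a Poisson process `N`
of rate `lam`, and jumps `X 1, X 2, …` which are i.i.d. `G`-valued random variables, the whole
family of jumps being independent of the process `N`. By convention `X 0` is the identity. -/
structure IsCompoundPoissonData {Ω G : Type*} [MeasurableSpace Ω] [Group G] [MeasurableSpace G]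
    (lam : ℝ≥0) (N : ℝ≥0 → Ω → ℕ) (X : ℕ → Ω → G) (P : Measure Ω) : Prop where
  poisson : IsPoissonProcess lam N P
  jump_zero : ∀ ω, X 0 ω = 1
  jump_measurable : ∀ n, 1 ≤ n → Measurable (X n)
  jump_indep : iIndepFun (fun n ↦ X (n + 1)) P
  jump_ident : ∀ n, 1 ≤ n → IdentDistrib (X n) (X 1) P P
  indep : IndepFun (fun ω (n : ℕ) ↦ X (n + 1) ω) (fun ω (t : ℝ≥0) ↦ N t ω) P

/-- The left compound Poisson process `Y(t) = X_0 X_1 ⋯ X_{N(t)}`, the product being ordered from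
left to right. -/
def leftCompoundPoisson {Ω G : Type*} [Group G] (N : ℝ≥0 → Ω → ℕ) (X : ℕ → Ω → G)
    (t : ℝ≥0) (ω : Ω) : G :=
  ((List.range (N t ω + 1)).map fun n ↦ X n ω).prod

/-- `Z` and `Z⁻¹` are equal in distribution. -/
def IsInverseInvariant {Ω G : Type*} [MeasurableSpace Ω] [Group G] [MeasurableSpace G]
    (Z : Ω → G) (P : Measure Ω) : Prop :=
  IdentDistrib Z (fun ω ↦ (Z ω)⁻¹) P P

/-- For every `k`, `Z` and `k Z k⁻¹` are equal in distribution. -/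
def IsConjugateInvariant {Ω G : Type*} [MeasurableSpace Ω] [Group G] [MeasurableSpace G]
    (Z : Ω → G) (P : Measure Ω) : Prop :=
  ∀ k : G, IdentDistrib Z (fun ω ↦ k * Z ω * k⁻¹) P P

/-! Let μ be the law of `X 1`. Conditioning on `N t`, which is independent of the jumps, writes the
law of Y(t) as the mixture over n of the convolution powers of μ, weighted by P(N(t) = n)
(`IsCompoundPoissonData.map_left`). Pushforward is linear, so any map fixing every power of μ fixes
the law of Y(t). Conjugation is a homomorphism and so respects convolution; inversion reverses the
factors, which is harmless because all of them are equal to μ. -/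

/-- The `n`-fold convolution power of a measure on a monoid. -/
noncomputable def mconvPower {M : Type*} [Monoid M] [MeasurableSpace M] (μ : Measure M) :
    ℕ → Measure M
  | 0 => Measure.dirac 1
  | n + 1 => Measure.mconv (mconvPower μ n) μ

section ConvolutionPower

open scoped MeasureTheory

variable {M : Type*} [Monoid M] [MeasurableSpace M] [MeasurableMul₂ M]

instance isProbabilityMeasure_mconvPower (μ : Measure M) [IsProbabilityMeasure μ] (n : ℕ) :
    IsProbabilityMeasure (mconvPower μ n) := by
  induction n with
  | zero => rw [mconvPower]; infer_instance
  | succ n ih => rw [mconvPower]; infer_instance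

/-- Associativity alone suffices, even when the monoid is not commutative. This undoes the reversal
caused by inversion. -/
theorem mconv_mconvPower_comm (μ : Measure M) [IsProbabilityMeasure μ] (n : ℕ) :
    μ ∗ₘ mconvPower μ n = mconvPower μ n ∗ₘ μ := by
  induction n with
  | zero => rw [mconvPower, Measure.mconv_dirac_one, Measure.dirac_one_mconv]
  | succ n ih => rw [mconvPower, ← Measure.mconv_assoc, ih]

theorem map_mconvPower_of_monoidHom {μ : Measure M} [IsProbabilityMeasure μ] {φ : M →* M}
    (hφ : Measurable φ) (hμ : μ.map φ = μ) (n : ℕ) :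
    (mconvPower μ n).map φ = mconvPower μ n := by
  induction n with
  | zero => rw [mconvPower, Measure.map_dirac' hφ, map_one]
  | succ n ih => rw [mconvPower, Measure.map_mconv_monoidHom φ hφ, ih, hμ]

end ConvolutionPower

section Inverse

open scoped MeasureTheory

variable {G : Type*} [Group G] [MeasurableSpace G] [MeasurableMul₂ G] [MeasurableInv G]

/-- Since (xy)⁻¹ = y⁻¹x⁻¹, the order of the factors flips; on product measures this is the
coordinate swap. -/
theorem map_inv_mconv (μ ν : Measure G) [SFinite μ] [SFinite ν] :
    (μ ∗ₘ ν).map (fun g ↦ g⁻¹) = ν.map (fun g ↦ g⁻¹) ∗ₘ μ.map (fun g ↦ g⁻¹) := by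
  unfold Measure.mconv
  rw [Measure.map_prod_map _ _ measurable_inv measurable_inv, ← Measure.prod_swap,
    Measure.map_map (by fun_prop) (by fun_prop), Measure.map_map (by fun_prop) (by fun_prop),
    Measure.map_map (by fun_prop) (by fun_prop)]
  congr 1
  ext x
  simp

theorem map_inv_mconvPower {μ : Measure G} [IsProbabilityMeasure μ]
    (hμ : μ.map (fun g ↦ g⁻¹) = μ) (n : ℕ) :
    (mconvPower μ n).map (fun g ↦ g⁻¹) = mconvPower μ n := by
  induction n with
  | zero => rw [mconvPower, Measure.map_dirac' measurable_inv, inv_one]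
  | succ n ih => rw [mconvPower, map_inv_mconv, ih, hμ, mconv_mconvPower_comm]

end Inverse

section OrderedProduct

variable {M Ω : Type*} [Monoid M] [MeasurableSpace M] [MeasurableMul₂ M] [MeasurableSpace Ω]

/-- The ordered product `x 0 * x 1 * ⋯ * x (n - 1)` of a sequence in a monoid. -/
def orderedProd {M : Type*} [Monoid M] (n : ℕ) (x : ℕ → M) : M :=
  ((List.range n).map x).prod

theorem orderedProd_succ {M : Type*} [Monoid M] (n : ℕ) (x : ℕ → M) :
    orderedProd (n + 1) x = orderedProd n x * x n := by
  simp [orderedProd, List.range_succ]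

theorem orderedProd_congr {M : Type*} [Monoid M] {n : ℕ} {x y : ℕ → M}
    (h : ∀ i < n, x i = y i) : orderedProd n x = orderedProd n y := by
  unfold orderedProd
  rw [List.map_congr_left fun i hi ↦ h i (List.mem_range.1 hi)]

theorem measurable_orderedProd (n : ℕ) : Measurable (orderedProd n : (ℕ → M) → M) := by
  induction n with
  | zero => exact measurable_const
  | succ n ih =>
    simp_rw [funext (orderedProd_succ (M := M) n)]
    exact ih.mul (measurable_pi_apply n)

theorem indepFun_orderedProd {P : Measure Ω} {X : ℕ → Ω → M} (hX : iIndepFun X P)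
    (hmeas : ∀ n, Measurable (X n)) (n : ℕ) :
    IndepFun (fun ω ↦ orderedProd n fun i ↦ X i ω) (X n) P := by
  have h := hX.indepFun_finset (Finset.range n) {n} (by simp) hmeas
  -- Padding by 1 turns a finite block into a sequence; `orderedProd n` never reads the padded
  -- entries.
  let extend : (Finset.range n → M) → ℕ → M :=
    fun x i ↦ if hi : i ∈ Finset.range n then x ⟨i, hi⟩ else 1
  have hextend : Measurable extend := by
    refine measurable_pi_iff.2 fun i ↦ ?_
    by_cases hi : i ∈ Finset.range n
    · simp only [extend, hi, dite_true]
      fun_prop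
    · simp only [extend, hi, dite_false]
      fun_prop
  have hcomp := h.comp ((measurable_orderedProd n).comp hextend)
    (measurable_pi_apply (⟨n, Finset.mem_singleton_self n⟩ : ({n} : Finset ℕ)))
  have hprod : (fun ω ↦ orderedProd n fun i ↦ X i ω) =
      (orderedProd n ∘ extend) ∘ fun ω (i : Finset.range n) ↦ X i ω := by
    ext ω
    exact orderedProd_congr fun i hi ↦ by simp [extend, hi]
  rw [hprod]
  exact hcomp

theorem map_orderedProd {P : Measure Ω} [IsProbabilityMeasure P] {X : ℕ → Ω → M}
    (hX : iIndepFun X P) (hmeas : ∀ n, Measurable (X n)) {μ : Measure M}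
    (hlaw : ∀ n, P.map (X n) = μ) (n : ℕ) :
    P.map (fun ω ↦ orderedProd n fun i ↦ X i ω) = mconvPower μ n := by
  induction n with
  | zero => simp [orderedProd, mconvPower]
  | succ n ih =>
    simp_rw [orderedProd_succ]
    rw [mconvPower, ← ih, ← hlaw n]
    exact (indepFun_orderedProd hX hmeas n).map_mul_eq_map_mconv_map
      ((measurable_orderedProd n).comp (measurable_pi_iff.2 hmeas)) (hmeas n)

/-- Law of a family of random variables evaluated at an independent random index. -/
theorem map_eval_indep_index {S T : Type*} [MeasurableSpace S] [MeasurableSpace T]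
    {P : Measure Ω} {K : Ω → ℕ} {J : Ω → S} {F : ℕ → S → T}
    (hK : Measurable K) (hJ : Measurable J) (hF : ∀ n, Measurable (F n)) (hJK : IndepFun J K P) :
    P.map (fun ω ↦ F (K ω) (J ω)) =
      Measure.sum fun n ↦ P (K ⁻¹' {n}) • P.map fun ω ↦ F n (J ω) := by
  have hFK : Measurable fun ω ↦ F (K ω) (J ω) :=
    (measurable_from_prod_countable_right (f := fun p : ℕ × S ↦ F p.1 p.2) hF).comp
      (hK.prodMk hJ)
  ext A hA
  rw [Measure.map_apply hFK hA, Measure.sum_apply _ hA]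
  -- Split by the value of `K`; on each piece the index is constant and independence factors the
  -- probability.
  have hunion : (fun ω ↦ F (K ω) (J ω)) ⁻¹' A =
      ⋃ n, J ⁻¹' (F n ⁻¹' A) ∩ K ⁻¹' {n} := by
    ext ω
    simp
  rw [hunion, measure_iUnion]
  · refine tsum_congr fun n ↦ ?_
    rw [hJK.measure_inter_preimage_eq_mul _ _ (hF n hA) (measurableSet_singleton n),
      Measure.smul_apply, smul_eq_mul, mul_comm, ← Set.preimage_comp,
      ← Measure.map_apply ((hF n).comp hJ) hA, Function.comp_def]
  · intro m n hmn
    refine Set.disjoint_left.2 fun ω hm hn ↦ hmn ?_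
    exact hm.2.symm.trans hn.2
  · exact fun n ↦ (hJ (hF n hA)).inter (hK (measurableSet_singleton n))

end OrderedProduct

section CompoundPoisson

/-- The factor `X 0 = 1` drops out, leaving exactly `N t ω` i.i.d. jumps. -/
theorem leftCompoundPoisson_eq_orderedProd {Ω G : Type*} [Group G] {N : ℝ≥0 → Ω → ℕ}
    {X : ℕ → Ω → G} (hX : ∀ ω, X 0 ω = 1) (t : ℝ≥0) (ω : Ω) :
    leftCompoundPoisson N X t ω = orderedProd (N t ω) fun n ↦ X (n + 1) ω := by
  simp [leftCompoundPoisson, orderedProd, List.range_succ_eq_map, hX, Function.comp_def]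

theorem map_eq_of_identDistrib_comp {Ω S : Type*} [MeasurableSpace Ω] [MeasurableSpace S]
    {P : Measure Ω} {Z : Ω → S} {φ : S → S} (hφ : Measurable φ)
    (hZ : IdentDistrib Z (fun ω ↦ φ (Z ω)) P P) : (P.map Z).map φ = P.map Z := by
  rw [AEMeasurable.map_map_of_aemeasurable hφ.aemeasurable hZ.aemeasurable_fst]
  exact hZ.map_eq.symm

variable {Ω G : Type*} [MeasurableSpace Ω] [Group G] [MeasurableSpace G]
  {lam : ℝ≥0} {N : ℝ≥0 → Ω → ℕ} {X : ℕ → Ω → G} {P : Measure Ω}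

theorem IsCompoundPoissonData.measurable_jumps (h : IsCompoundPoissonData lam N X P) :
    Measurable fun ω (n : ℕ) ↦ X (n + 1) ω :=
  measurable_pi_iff.2 fun n ↦ h.jump_measurable (n + 1) n.succ_pos

variable [MeasurableMul₂ G]

theorem IsCompoundPoissonData.measurable_left (h : IsCompoundPoissonData lam N X P) (t : ℝ≥0) :
    Measurable (leftCompoundPoisson N X t) := by
  rw [funext (leftCompoundPoisson_eq_orderedProd h.jump_zero t)]
  exact (measurable_from_prod_countable_right
    (f := fun p : ℕ × (ℕ → G) ↦ orderedProd p.1 p.2) measurable_orderedProd).comp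
      ((h.poisson.measurable t).prodMk h.measurable_jumps)

/-- The law of a compound Poisson process is a mixture of convolution powers of the jump law. -/
theorem IsCompoundPoissonData.map_left [IsProbabilityMeasure P]
    (h : IsCompoundPoissonData lam N X P) (t : ℝ≥0) :
    P.map (leftCompoundPoisson N X t) =
      Measure.sum fun n ↦ P (N t ⁻¹' {n}) • mconvPower (P.map (X 1)) n := by
  have hindep : IndepFun (fun ω (n : ℕ) ↦ X (n + 1) ω) (N t) P :=
    h.indep.comp measurable_id (measurable_pi_apply t)
  rw [funext (leftCompoundPoisson_eq_orderedProd h.jump_zero t),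
    map_eval_indep_index (h.poisson.measurable t) h.measurable_jumps measurable_orderedProd hindep]
  congr with n : 1
  rw [map_orderedProd h.jump_indep (fun n ↦ h.jump_measurable (n + 1) n.succ_pos)
    (fun n ↦ (h.jump_ident (n + 1) n.succ_pos).map_eq)]

theorem IsCompoundPoissonData.identDistrib_left [IsProbabilityMeasure P]
    (h : IsCompoundPoissonData lam N X P) (t : ℝ≥0) {φ : G → G} (hφ : Measurable φ)
    (hpow : ∀ n, (mconvPower (P.map (X 1)) n).map φ = mconvPower (P.map (X 1)) n) :
    IdentDistrib (leftCompoundPoisson N X t) (fun ω ↦ φ (leftCompoundPoisson N X t ω)) P P := by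
  have hY := h.measurable_left t
  refine ⟨hY.aemeasurable, (hφ.comp hY).aemeasurable, ?_⟩
  change _ = P.map (φ ∘ leftCompoundPoisson N X t)
  rw [← Measure.map_map hφ hY, h.map_left t, Measure.map_sum hφ.aemeasurable]
  simp_rw [Measure.map_smul, hpow]

end CompoundPoisson

theorem proposition4
    {E : Type*} [NormedAddCommGroup E] [NormedSpace ℝ E] [FiniteDimensional ℝ E]
    {G : Type*} [TopologicalSpace G] [ChartedSpace E G] [Group G] [LieGroup 𝓘(ℝ, E) ((⊤ : ℕ∞) : WithTop ℕ∞) G]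
    [T2Space G] [CompactSpace G] [ConnectedSpace G]
    [MeasurableSpace G] [BorelSpace G]
    {Ω : Type*} [MeasurableSpace Ω] (P : Measure Ω) [IsProbabilityMeasure P]
    (lam : ℝ≥0) (hlam : 0 < lam) (N : ℝ≥0 → Ω → ℕ) (X : ℕ → Ω → G)
    (hNX : IsCompoundPoissonData lam N X P) (t : ℝ≥0) :
    (IsInverseInvariant (X 1) P → IsInverseInvariant (leftCompoundPoisson N X t) P) ∧
    (IsConjugateInvariant (X 1) P → IsConjugateInvariant (leftCompoundPoisson N X t) P) := by
  have : IsTopologicalGroup G := topologicalGroup_of_lieGroup 𝓘(ℝ, E) ((⊤ : ℕ∞) : WithTop ℕ∞)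
  have : ProperSpace E := FiniteDimensional.proper ℝ E
  -- Second countability makes multiplication jointly measurable for the product of the Borel
  -- σ-algebras.
  have : SecondCountableTopology G := ChartedSpace.secondCountable_of_sigmaCompact E G
  have : IsProbabilityMeasure (P.map (X 1)) :=
    Measure.isProbabilityMeasure_map (hNX.jump_measurable 1 le_rfl).aemeasurable
  refine ⟨fun hX ↦ ?_, fun hX k ↦ ?_⟩
  · exact hNX.identDistrib_left t measurable_inv
      (map_inv_mconvPower (map_eq_of_identDistrib_comp measurable_inv hX))
  · have hφ : Measurable (MulAut.conj k).toMonoidHom :=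
      (measurable_id.const_mul k).mul_const k⁻¹
    exact hNX.identDistrib_left t hφ
      (map_mconvPower_of_monoidHom hφ (map_eq_of_identDistrib_comp hφ (hX k)))
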